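/- Let $X=\{0,1\}^{\mathbb N}$ be the Cantor space with the metric $d(\sigma,\tau)=1/n$, where $n\ge 1$ is the least position at which $\sigma$ and $\tau$ differ if $\sigma\ne\tau$ (and $d(\sigma,\sigma)=0$). Let $\mathcal H(X)$ be the space of homeomorphisms of $X$ onto itself with the metric $\tilde d(f,g)=\max_{x\in X}d(f(x),g(x))$, and let $\mathcal M(X)$ be the space of Borel probability measures on $X$ with the Prokhorov metric $d_P(\mu,\nu)=\inf\{\delta>0:\ \mu(B)\le\nu(B^\delta)+\delta\text{ and }\nu(B)\le\mu(B^\delta)+\delta\text{ for all Borel }B\subset X\}$, where $B^\delta$ is the open $\delta$-neighbourhood of $B$. For $h\in\mathcal H(X)$ let $\tilde h:\mathcal M(X)\to\mathcal M(X)$ be given by $\tilde h(\mu)(B)=\mu(h^{-1}(B))$. For a self-map $f$ of a metric space $(Y,\rho)$: a point $x$ is periodic of period $p\ge1$ if $f^p(x)=x$ and $f^j(x)\ne x$ for $1\le j<p$; $P(f)$ is the set of periodic points; $R(f)$ is the set of recurrent points, i.e. of those $x$ such that every neighbourhood of $x$ contains $f^n(x)$ for some $n\ge1$; $\Omega(f)$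 is the set of nonwandering points, i.e. of those $x$ such that for every neighbourhood $U$ of $x$ there is $n\ge1$ with $f^n(U)\cap U\ne\emptyset$; and $CR(f)$ is the set of chain recurrent points, i.e. of those $x$ such that for every $\delta>0$ there are $k\ge1$ and points $x=x_0,x_1,\dots,x_k=x$ with $\rho(f(x_n),x_{n+1})<\delta$ for $0\le n<k$. Then the set of all $h\in\mathcal H(X)$ that do not satisfy all of the following properties is of the first category in $\mathcal H(X)$: (a) for every $p\ge1$, $\tilde h$ has uncountably many periodic points of period $p$; (b) for all $p,k\ge1$, every neighbourhood of every periodic point of $\tilde h$ of period $p$ contains uncountably many periodic points of $\tilde h$ of period $kp$; (c) $R(\tilde h)=\Omega(\tilde h)$ and $CR(\tilde h)=\mathcal M(X)$; (d) $\Omega(\tilde h)$ has empty interior in $\mathcal M(X)$; (e) $P(\tilde h)$ is dense in $\Omega(\tilde h)$, that is, $P(\tilde h)\subset\Omega(\tilde h)\subset\overline{P(\tilde h)}$. -/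

import Mathlib

open Set Filter Topology MeasureTheory

namespace InducedDynamics

/-! ### The Cantor space `{0,1}^ℕ` with the metric `1/n` -/

/-- The Cantor space `{0,1}^ℕ`, sequences of zeros and ones. -/
def Cantor : Type := ℕ → Bool

open scoped Classical in
/-- The distance `d(σ, σ) = 0` and `d(σ, τ) = 1 / n` for `σ ≠ τ`, where `n` is the least position
at which `σ` and `τ` differ, positions being counted from `1`. As the coordinates are
numbered from `0`, this position is `PiNat.firstDiff σ τ + 1`. -/
noncomputable def cantorDist (σ τ : ℕ → Bool) : ℝ :=
  if σ = τ then 0 else 1 / ((PiNat.firstDiff σ τ : ℝ) + 1)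

lemma cantorDist_self (σ : ℕ → Bool) : cantorDist σ σ = 0 := by
  simp [cantorDist]

lemma cantorDist_comm (σ τ : ℕ → Bool) : cantorDist σ τ = cantorDist τ σ := by
  unfold cantorDist
  rw [PiNat.firstDiff_comm σ τ]
  by_cases h : σ = τ
  · rw [if_pos h, if_pos h.symm]
  · rw [if_neg h, if_neg (Ne.symm h)]

lemma cantorDist_nonneg (σ τ : ℕ → Bool) : 0 ≤ cantorDist σ τ := by
  unfold cantorDist
  split_ifs
  · exact le_rfl
  · positivity

lemma eq_of_cantorDist_eq_zero (σ τ : ℕ → Bool) (h : cantorDist σ τ = 0) : σ = τ := by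
  by_contra hne
  have hpos : 0 < cantorDist σ τ := by
    rw [cantorDist, if_neg hne]
    positivity
  exact hpos.ne' h

lemma cantorDist_triangle (ρ σ τ : ℕ → Bool) :
    cantorDist ρ τ ≤ cantorDist ρ σ + cantorDist σ τ := by
  by_cases h1 : ρ = τ
  · subst h1
    rw [cantorDist_self]
    exact add_nonneg (cantorDist_nonneg _ _) (cantorDist_nonneg _ _)
  by_cases h2 : ρ = σ
  · subst h2
    simp [cantorDist_self]
  by_cases h3 : σ = τ
  · subst h3
    simp [cantorDist_self]
  have key := PiNat.min_firstDiff_le ρ σ τ h1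
  rcases min_le_iff.1 key with h | h
  · refine le_add_of_le_of_nonneg ?_ (cantorDist_nonneg _ _)
    rw [cantorDist, cantorDist, if_neg h1, if_neg h2]
    exact one_div_le_one_div_of_le (by positivity) (by exact_mod_cast Nat.succ_le_succ h)
  · refine le_add_of_nonneg_of_le (cantorDist_nonneg _ _) ?_
    rw [cantorDist, cantorDist, if_neg h1, if_neg h3]
    exact one_div_le_one_div_of_le (by positivity) (by exact_mod_cast Nat.succ_le_succ h)

lemma cantorDist_lt_iff (σ τ : ℕ → Bool) (n : ℕ) :
    cantorDist σ τ < 1 / ((n : ℝ) + 1) ↔ ∀ i ≤ n, τ i = σ i := by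
  by_cases h : σ = τ
  · subst h
    simp only [cantorDist_self, implies_true, iff_true]
    positivity
  have hmem := PiNat.mem_cylinder_iff_le_firstDiff (x := τ) (y := σ)
    (Ne.symm h) (n + 1)
  rw [PiNat.firstDiff_comm τ σ] at hmem
  rw [cantorDist, if_neg h, one_div_lt_one_div (by positivity) (by positivity),
    add_lt_add_iff_right, Nat.cast_lt, ← Nat.succ_le_iff, Nat.succ_eq_add_one, ← hmem]
  simp only [PiNat.mem_cylinder_iff, Nat.lt_succ_iff]

/-- The distance `cantorDist` induces the product topology. -/
lemma isOpen_iff_cantorDist (s : Set (ℕ → Bool)) :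
    IsOpen s ↔ ∀ σ ∈ s, ∃ ε > 0, ∀ τ, cantorDist σ τ < ε → τ ∈ s := by
  constructor
  · intro hs σ hσ
    obtain ⟨v, ⟨⟨x, n, rfl⟩, hxσ, hvs⟩⟩ :=
      (PiNat.isTopologicalBasis_cylinders (fun _ : ℕ => Bool)).exists_subset_of_mem_open
        (a := σ) (u := s) hσ hs
    refine ⟨1 / ((n : ℝ) + 1), by positivity, fun τ hτ => hvs ?_⟩
    rw [cantorDist_lt_iff] at hτ
    intro i hi
    exact (hτ i hi.le).trans (hxσ i hi)
  · intro h
    rw [isOpen_iff_mem_nhds]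
    intro σ hσ
    obtain ⟨ε, hε, hs⟩ := h σ hσ
    obtain ⟨n, hn⟩ := exists_nat_one_div_lt hε
    have hopen : IsOpen (PiNat.cylinder σ (n + 1)) :=
      PiNat.isOpen_cylinder (fun _ : ℕ => Bool) σ (n + 1)
    refine mem_of_superset
      (hopen.mem_nhds (PiNat.self_mem_cylinder σ (n + 1))) ?_
    intro τ hτ
    refine hs τ (lt_trans ?_ hn)
    rw [cantorDist_lt_iff]
    intro i hi
    exact hτ i (Nat.lt_succ_of_le hi)

/-- The metric `cantorDist`; its topology is, definitionally, the product topology of discrete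
factors. -/
noncomputable instance : MetricSpace Cantor :=
  MetricSpace.ofDistTopology (α := ℕ → Bool) cantorDist cantorDist_self cantorDist_comm
    cantorDist_triangle isOpen_iff_cantorDist eq_of_cantorDist_eq_zero

instance : CompactSpace Cantor := inferInstanceAs (CompactSpace (ℕ → Bool))

/-- The Borel σ-algebra. -/
noncomputable instance : MeasurableSpace Cantor := borel Cantor

instance : BorelSpace Cantor := ⟨rfl⟩

/-! ### The space of homeomorphisms -/

/-- The space of homeomorphisms of a compact metric space `X`, with the uniform metric
`d(f, g) = max_x d(f x, g x)`, which is the metric of the space `C(X, X)` of continuous maps. -/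
noncomputable instance homeomorphMetricSpace {X : Type*} [MetricSpace X] [CompactSpace X] :
    MetricSpace (X ≃ₜ X) :=
  MetricSpace.induced (fun h : X ≃ₜ X => (ContinuousMap.mk h h.continuous : C(X, X)))
    (fun _ _ hfg => Homeomorph.ext fun x => DFunLike.congr_fun hfg x) inferInstance

/-! ### The space of probability measures and the induced map -/

/-- The space of Borel probability measures on `X` with the Prokhorov metric
`inf {δ > 0 | μ B ≤ ν (B^δ) + δ and ν B ≤ μ (B^δ) + δ for all Borel B}`. -/
abbrev Prob (X : Type*) [MeasurableSpace X] : Type _ :=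
  LevyProkhorov (ProbabilityMeasure X)

/-- The map induced by the homeomorphism `h` on probability measures,
`μ ↦ (B ↦ μ (h⁻¹ B))`. -/
noncomputable def inducedMap {X : Type*} [MetricSpace X] [MeasurableSpace X] [BorelSpace X]
    (h : X ≃ₜ X) (μ : Prob X) : Prob X :=
  LevyProkhorov.ofMeasure (μ.toMeasure.map h.continuous.measurable.aemeasurable)

/-! ### Recurrence notions for a self-map -/

/-- The points of period exactly `p` (for `p ≥ 1`): `f^p x = x` and `f^j x ≠ x` for
`1 ≤ j < p`. -/
def pointsOfPeriod {Y : Type*} (f : Y → Y) (p : ℕ) : Set Y :=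
  {x | f^[p] x = x ∧ ∀ j, 1 ≤ j → j < p → f^[j] x ≠ x}

/-- `P(f)`: the periodic points of `f`. -/
def periodicSet {Y : Type*} (f : Y → Y) : Set Y :=
  {x | ∃ p, 1 ≤ p ∧ f^[p] x = x}

/-- `R(f)`: the recurrent points, which return to each of their neighborhoods. -/
def recurrentSet {Y : Type*} [TopologicalSpace Y] (f : Y → Y) : Set Y :=
  {x | ∀ U ∈ 𝓝 x, ∃ n, 1 ≤ n ∧ f^[n] x ∈ U}

/-- `Ω(f)`: the nonwandering points, each neighborhood `U` of which satisfies
`f^n(U) ∩ U ≠ ∅` for some `n ≥ 1`. -/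
def nonwanderingSet {Y : Type*} [TopologicalSpace Y] (f : Y → Y) : Set Y :=
  {x | ∀ U ∈ 𝓝 x, ∃ n, 1 ≤ n ∧ ((f^[n] '' U) ∩ U).Nonempty}

/-- `(c 0, …, c k)` is a `δ`-chain of length `k` from `x` to `y`. -/
def IsDeltaChain {Y : Type*} [PseudoMetricSpace Y] (f : Y → Y) (δ : ℝ) (k : ℕ) (c : ℕ → Y)
    (x y : Y) : Prop :=
  c 0 = x ∧ c k = y ∧ ∀ n < k, dist (f (c n)) (c (n + 1)) < δ

/-- `CR(f)`: the chain recurrent points, those with a `δ`-chain of positive length back to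
themselves for every `δ > 0`. -/
def chainRecurrentSet {Y : Type*} [PseudoMetricSpace Y] (f : Y → Y) : Set Y :=
  {x | ∀ δ > 0, ∃ k, 1 ≤ k ∧ ∃ c : ℕ → Y, IsDeltaChain f δ k c x x}

end InducedDynamics

open InducedDynamics

/-! The argument is a Baire category argument. For each `m > 0`, `IsResolved h m (1 / m)` is an open
dense condition on `h` (`isOpen_isResolved`, `dense_isResolved`), and all of these conditions
together imply (a)-(e) (`properties_of_isResolved`).

A nonwandering measure gives no mass to the points whose rank increases (`mass_rank_lt_eq_zero`).
After a multiple of `n` steps almost every point therefore has its old label, rank and phase, and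
lies near its initial position (`IsResolved.exists_return`). This yields recurrence and, by
averaging along the orbit, nearby periodic measures. Mixing in a point mass at a point of increasing
rank makes any measure wandering, hence the empty interior. A class of the phase modulo `p` inside a
label class carries a measure of period `p`, two labels give two such measures, and a segment
between measures gives uncountably many. Chain recurrence holds for every homeomorphism.

For density, the space is cut into small cells. Each cell is followed forwards and backwards through
the finite set of cells until both paths become periodic, which gives a graph of two loops joined by
a bar. Cantor sets over the vertices of these graphs carry a homeomorphism that follows the edges
(`exists_model`), and transporting it to the space gives a resolved perturbation of `h`
(`exists_isResolved_near`). -/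

namespace InducedDynamics

/-! ### Probability measures, convex combinations and distance estimates -/

section Measures

variable {X : Type*} [MeasurableSpace X]

/-- The mass `μ B` as a real number. -/
noncomputable def mass (μ : Prob X) (B : Set X) : ℝ :=
  (μ.toMeasure : Measure X).real B

lemma mass_nonneg (μ : Prob X) (B : Set X) : 0 ≤ mass μ B := measureReal_nonneg

lemma mass_le_one (μ : Prob X) (B : Set X) : mass μ B ≤ 1 := measureReal_le_one

lemma mass_univ (μ : Prob X) : mass μ univ = 1 := by simp [mass]

lemma mass_mono (μ : Prob X) {A B : Set X} (h : A ⊆ B) : mass μ A ≤ mass μ B :=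
  measureReal_mono h

lemma exists_mass_eq_one (x : X) : ∃ ν : Prob X, ∀ B, x ∈ B → mass ν B = 1 := by
  refine ⟨LevyProkhorov.ofMeasure ⟨Measure.dirac x, inferInstance⟩, fun B hx => ?_⟩
  change (Measure.dirac x).real B = 1
  rw [measureReal_def, Measure.dirac_apply_of_mem hx, ENNReal.toReal_one]

lemma prob_ext {μ ν : Prob X} (h : ∀ B, MeasurableSet B → mass μ B = mass ν B) : μ = ν := by
  apply LevyProkhorov.toMeasure_injective
  apply Subtype.ext
  change (μ.toMeasure : Measure X) = (ν.toMeasure : Measure X)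
  refine Measure.ext fun B hB => ?_
  exact (measureReal_eq_measureReal_iff (measure_ne_top _ _) (measure_ne_top _ _)).1 (h B hB)

lemma exists_convexComb {ι : Type*} (s : Finset ι) (w : ι → ℝ) (hw : ∀ i ∈ s, 0 ≤ w i)
    (hs : ∑ i ∈ s, w i = 1) (μ : ι → Prob X) :
    ∃ ν : Prob X, ∀ B, mass ν B = ∑ i ∈ s, w i * mass (μ i) B := by
  let m : Measure X := ∑ i ∈ s, ENNReal.ofReal (w i) • ((μ i).toMeasure : Measure X)
  have hm : IsProbabilityMeasure m := by
    constructor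
    simp only [m, Measure.coe_finsetSum, Finset.sum_apply, Measure.smul_apply, measure_univ,
      smul_eq_mul, mul_one]
    rw [← ENNReal.ofReal_sum_of_nonneg hw, hs, ENNReal.ofReal_one]
  refine ⟨LevyProkhorov.ofMeasure ⟨m, hm⟩, fun B => ?_⟩
  simp only [mass, measureReal_def, ProbabilityMeasure.coe_mk, m, Measure.coe_finsetSum,
    Finset.sum_apply, Measure.smul_apply, smul_eq_mul]
  rw [ENNReal.toReal_sum fun i _ => ENNReal.mul_ne_top ENNReal.ofReal_ne_top (measure_ne_top _ _)]
  refine Finset.sum_congr rfl fun i hi => ?_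
  rw [ENNReal.toReal_mul, ENNReal.toReal_ofReal (hw i hi)]

lemma exists_segment (μ ν : Prob X) : ∃ γ : ℝ → Prob X, ∀ t, 0 ≤ t → t ≤ 1 →
    ∀ B, mass (γ t) B = (1 - t) * mass μ B + t * mass ν B := by
  have H : ∀ t : ℝ, ∃ ρ : Prob X, 0 ≤ t → t ≤ 1 →
      ∀ B, mass ρ B = (1 - t) * mass μ B + t * mass ν B := by
    intro t
    by_cases ht : 0 ≤ t ∧ t ≤ 1
    · obtain ⟨ρ, hρ⟩ := exists_convexComb Finset.univ (fun b : Bool => cond b t (1 - t))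
        (by rintro (_ | _) _ <;> simp <;> linarith) (by simp) (fun b => cond b ν μ)
      refine ⟨ρ, fun _ _ B => ?_⟩
      rw [hρ]
      simp [add_comm]
    -- Outside `[0, 1]` the value is arbitrary.
    · exact ⟨μ, fun h0 h1 => absurd ⟨h0, h1⟩ ht⟩
  choose γ hγ using H
  exact ⟨γ, hγ⟩

variable [MetricSpace X] [BorelSpace X]

lemma mass_inducedMap (h : X ≃ₜ X) (μ : Prob X) {B : Set X} (hB : MeasurableSet B) :
    mass (inducedMap h μ) B = mass μ (h ⁻¹' B) := by
  simp only [mass, inducedMap, ProbabilityMeasure.toMeasure_map]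
  exact map_measureReal_apply h.continuous.measurable hB

lemma mass_iterate (h : X ≃ₜ X) (μ : Prob X) (k : ℕ) {B : Set X} (hB : MeasurableSet B) :
    mass ((inducedMap h)^[k] μ) B = mass μ (h^[k] ⁻¹' B) := by
  induction k generalizing B with
  | zero => rfl
  | succ k ih =>
    rw [Function.iterate_succ_apply', mass_inducedMap h _ hB,
      ih (h.continuous.measurable hB), Function.iterate_succ', preimage_comp]

/-- For probability measures one of the two Prokhorov inequalities implies the other, by passing to
complements. -/
lemma dist_le_of_mass_le_thickening {μ ν : Prob X} {δ : ℝ} (hδ : 0 ≤ δ)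
    (h : ∀ ε B, δ < ε → MeasurableSet B → mass μ B ≤ mass ν (Metric.thickening ε B) + ε) :
    dist μ ν ≤ δ := by
  rw [LevyProkhorov.dist_probabilityMeasure_def]
  refine levyProkhorovDist_le_of_forall_le _ _ hδ fun ε B hε hB => ?_
  have h1 := h ε B hε hB
  have hε0 : 0 ≤ ε := hδ.trans hε.le
  simp only [mass] at h1
  rw [← ofReal_measureReal, ← ofReal_measureReal, ← ENNReal.ofReal_add measureReal_nonneg hε0]
  exact ENNReal.ofReal_le_ofReal h1

lemma dist_le_of_mass_le_add {μ ν : Prob X} {δ : ℝ}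
    (h : ∀ B, MeasurableSet B → mass μ B ≤ mass ν B + δ) : dist μ ν ≤ δ := by
  have hδ : 0 ≤ δ := by have := h univ MeasurableSet.univ; simpa [mass_univ] using this
  refine dist_le_of_mass_le_thickening hδ fun ε B hε hB => ?_
  have h1 := h B hB
  have h2 : mass ν B ≤ mass ν (Metric.thickening ε B) :=
    mass_mono ν (Metric.self_subset_thickening (hδ.trans_lt hε) B)
  linarith

lemma dist_segment_le {μ ν : Prob X} {γ : ℝ → Prob X}
    (hγ : ∀ t, 0 ≤ t → t ≤ 1 → ∀ B, mass (γ t) B = (1 - t) * mass μ B + t * mass ν B)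
    {t : ℝ} (h0 : 0 ≤ t) (h1 : t ≤ 1) : dist (γ t) μ ≤ t := by
  refine dist_le_of_mass_le_add fun B _ => ?_
  rw [hγ t h0 h1]
  nlinarith [mass_le_one ν B, mass_nonneg μ B]

lemma exists_segment_mem {μ ν : Prob X} {γ : ℝ → Prob X}
    (hγ : ∀ t, 0 ≤ t → t ≤ 1 → ∀ B, mass (γ t) B = (1 - t) * mass μ B + t * mass ν B)
    {U : Set (Prob X)} (hU : U ∈ 𝓝 μ) :
    ∃ δ, 0 < δ ∧ δ ≤ 1 ∧ ∀ t ∈ Ioo 0 δ, γ t ∈ U := by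
  obtain ⟨ε, hε, hεU⟩ := Metric.mem_nhds_iff.1 hU
  refine ⟨min ε 1, lt_min hε one_pos, min_le_right _ _, fun t ht => hεU ?_⟩
  have h1 : t < ε := ht.2.trans_le (min_le_left _ _)
  have h2 : t < 1 := ht.2.trans_le (min_le_right _ _)
  exact (dist_segment_le hγ ht.1.le h2.le).trans_lt h1

/-! ### Topology of the space of measures -/

section Compact

variable [CompactSpace X]

instance compactSpace_prob : CompactSpace (Prob X) :=
  (LevyProkhorov.probabilityMeasureHomeomorph (Ω := X)).compactSpace

/-- A clopen set has empty boundary, so weak convergence preserves its mass in the limit. This is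
why all later data are locally constant. -/
lemma continuous_mass_of_isClopen {K : Set X} (hK : IsClopen K) :
    Continuous fun μ : Prob X => mass μ K := by
  have h : Continuous fun μ : ProbabilityMeasure X => μ K := by
    rw [continuous_iff_continuousAt]
    intro μ
    exact ProbabilityMeasure.tendsto_measure_of_isClopen_of_tendsto tendsto_id hK
  exact NNReal.continuous_coe.comp
    (h.comp (LevyProkhorov.probabilityMeasureHomeomorph (Ω := X)).symm.continuous)

lemma continuous_inducedMap (h : X ≃ₜ X) : Continuous (inducedMap h) := by
  let e := LevyProkhorov.probabilityMeasureHomeomorph (Ω := X)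
  exact e.continuous.comp
    ((ProbabilityMeasure.continuous_map h.continuous).comp e.symm.continuous)

/-- Krylov-Bogoliubov: averages along the orbit of `μ` under the `p`-th iterate of the induced map
accumulate at a fixed point of this iterate. -/
lemma exists_iterate_fixed (h : X ≃ₜ X) (p : ℕ) (μ : Prob X) {F : Set (Prob X)}
    (hF : IsClosed F)
    (hA : ∀ (N : ℕ) (ν : Prob X), (∀ B, mass ν B =
      ∑ i ∈ Finset.range (N + 1), (1 / ((N : ℝ) + 1)) * mass ((inducedMap h)^[p * i] μ) B) →
      ν ∈ F) :
    ∃ ν ∈ F, (inducedMap h)^[p] ν = ν := by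
  have hex : ∀ N : ℕ, ∃ ν : Prob X, ∀ B, mass ν B =
      ∑ i ∈ Finset.range (N + 1), (1 / ((N : ℝ) + 1)) * mass ((inducedMap h)^[p * i] μ) B := by
    intro N
    refine exists_convexComb _ _ (fun _ _ => by positivity) ?_ _
    rw [Finset.sum_const, Finset.card_range, nsmul_eq_mul]
    push_cast
    field_simp
  choose a ha using hex
  obtain ⟨ν, hν⟩ := exists_clusterPt_of_compactSpace (map a atTop)
  have hνF : ν ∈ F := by
    have := hν.mono (show map a atTop ≤ 𝓟 F from
      le_principal_iff.2 (mem_map.2 (univ_mem' fun N => hA N _ (ha N))))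
    rwa [← mem_closure_iff_clusterPt, hF.closure_eq] at this
  refine ⟨ν, hνF, ?_⟩
  -- Applying the `p`-th iterate shifts the average by one term, so only the two end terms fail to
  -- cancel.
  have hdist : ∀ N, dist ((inducedMap h)^[p] (a N)) (a N) ≤ 1 / ((N : ℝ) + 1) := by
    intro N
    refine dist_le_of_mass_le_add fun B hB => ?_
    have hmeas : MeasurableSet (h^[p] ⁻¹' B) := (h.continuous.iterate p).measurable hB
    rw [mass_iterate h _ p hB, ha, ha]
    have hshift : ∀ i, mass ((inducedMap h)^[p * i] μ) (h^[p] ⁻¹' B) =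
        mass ((inducedMap h)^[p * (i + 1)] μ) B := by
      intro i
      rw [← mass_iterate h _ p hB, ← Function.iterate_add_apply, mul_add, mul_one, add_comm]
    simp only [hshift]
    rw [Finset.sum_range_succ (n := N), Finset.sum_range_succ' (n := N)]
    have h1 := mass_le_one ((inducedMap h)^[p * (N + 1)] μ) B
    have h2 := mass_nonneg ((inducedMap h)^[p * 0] μ) B
    have h3 : (0 : ℝ) < 1 / ((N : ℝ) + 1) := by positivity
    nlinarith
  have hcont : Continuous fun ρ : Prob X => dist ((inducedMap h)^[p] ρ) ρ :=
    ((continuous_inducedMap h).iterate p).dist continuous_id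
  have hlim : Tendsto (fun N => dist ((inducedMap h)^[p] (a N)) (a N)) atTop (𝓝 0) :=
    squeeze_zero (fun _ => dist_nonneg) hdist tendsto_one_div_add_atTop_nhds_zero_nat
  have hcl : ClusterPt (dist ((inducedMap h)^[p] ν) ν)
      (map (fun N => dist ((inducedMap h)^[p] (a N)) (a N)) atTop) := by
    have := hν.map (f := fun ρ : Prob X => dist ((inducedMap h)^[p] ρ) ρ) hcont.continuousAt
      tendsto_map
    rwa [Filter.map_map] at this
  have : dist ((inducedMap h)^[p] ν) ν = 0 := by
    have hne : (𝓝 (dist ((inducedMap h)^[p] ν) ν) ⊓ 𝓝 0).NeBot := hcl.neBot.mono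
      (inf_le_inf_left _ hlim)
    exact eq_of_nhds_neBot hne
  exact dist_eq_zero.1 this

end Compact

/-! ### Chain recurrence -/

lemma inducedMap_symm_left (h : X ≃ₜ X) (μ : Prob X) :
    inducedMap h (inducedMap h.symm μ) = μ := by
  refine prob_ext fun B hB => ?_
  rw [mass_inducedMap h _ hB, mass_inducedMap h.symm _ (h.continuous.measurable hB),
    ← preimage_comp]
  simp

/-- Every measure is chain recurrent: interpolate between its forward orbit and a backward
orbit. -/
lemma chainRecurrentSet_inducedMap (h : X ≃ₜ X) :
    chainRecurrentSet (inducedMap h) = univ := by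
  refine eq_univ_of_forall fun μ δ hδ => ?_
  obtain ⟨N, hN⟩ := exists_nat_one_div_lt hδ
  set T := inducedMap h
  set ν : Prob X := (inducedMap h.symm)^[N + 1] μ
  have hν : T^[N + 1] ν = μ :=
    (Function.LeftInverse.iterate (inducedMap_symm_left h) (N + 1)) μ
  choose γ hγ using fun j => exists_segment (T^[j] μ) (T^[j] ν)
  have hpos : (0 : ℝ) < (N : ℝ) + 1 := by positivity
  -- The weight moves from the orbit of `μ` to the orbit of `ν`, which reaches `μ` at time `N + 1`.
  -- The map preserves convex combinations, so each step errs only by the change `1 / (N + 1)` of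
  -- the weight.
  refine ⟨N + 1, by omega, fun j => γ j (j / ((N : ℝ) + 1)), ?_, ?_, ?_⟩
  · refine prob_ext fun B _ => ?_
    rw [hγ _ _ (by simp) (by simp)]
    simp
  · refine prob_ext fun B _ => ?_
    have : ((N + 1 : ℕ) : ℝ) / ((N : ℝ) + 1) = 1 := by push_cast; field_simp
    dsimp only
    rw [this, hγ _ _ zero_le_one le_rfl, hν]
    simp
  · intro j hj
    refine lt_of_le_of_lt (dist_le_of_mass_le_add fun B hB => ?_) hN
    have hj' : (j : ℝ) + 1 ≤ (N : ℝ) + 1 := by exact_mod_cast hj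
    have e1 : ((j + 1 : ℕ) : ℝ) / ((N : ℝ) + 1) = j / ((N : ℝ) + 1) + 1 / ((N : ℝ) + 1) := by
      push_cast; ring
    have l0 : 0 ≤ (j : ℝ) / ((N : ℝ) + 1) := by positivity
    have l1 : (0 : ℝ) < 1 / ((N : ℝ) + 1) := by positivity
    have l2 : (j : ℝ) / ((N : ℝ) + 1) + 1 / ((N : ℝ) + 1) ≤ 1 := by
      rw [← add_div, div_le_one hpos]; exact hj'
    have hm : MeasurableSet (h ⁻¹' B) := h.continuous.measurable hB
    dsimp only
    rw [e1, mass_inducedMap h _ hB, hγ _ _ l0 (by linarith), hγ _ _ (by linarith) l2,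
      ← mass_inducedMap h _ hB, ← mass_inducedMap h _ hB]
    change _ ≤ (1 - _) * mass (T^[j + 1] μ) B + _ * mass (T^[j + 1] ν) B + _
    rw [Function.iterate_succ_apply', Function.iterate_succ_apply']
    nlinarith [mass_le_one (T (T^[j] μ)) B, mass_nonneg (T (T^[j] ν)) B]

/-- Near a point fixed by the `n`-th iterate there are uncountably many points of period `n`,
provided there is another point of period `n`. -/
lemma not_countable_inter_pointsOfPeriod {h : X ≃ₜ X} {n : ℕ} {μ ν : Prob X}
    (hμ : (inducedMap h)^[n] μ = μ) (hν : ν ∈ pointsOfPeriod (inducedMap h) n) (hne : ν ≠ μ)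
    {U : Set (Prob X)} (hU : U ∈ 𝓝 μ) :
    ¬ (U ∩ pointsOfPeriod (inducedMap h) n).Countable := by
  obtain ⟨γ, hγ⟩ := exists_segment μ ν
  obtain ⟨δ, hδ, hδ1, hγU⟩ := exists_segment_mem hγ hU
  intro hcount
  have hform : ∀ t ∈ Ioo 0 δ, ∀ B, mass (γ t) B = (1 - t) * mass μ B + t * mass ν B :=
    fun t ht => hγ t ht.1.le (ht.2.le.trans hδ1)
  have hinj : InjOn γ (Ioo 0 δ) := by
    intro s hs t ht hst
    by_contra hst'
    apply hne
    refine prob_ext fun B _ => ?_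
    have h1 := hform s hs B
    rw [hst, hform t ht B] at h1
    have h2 : (t - s) * (mass ν B - mass μ B) = 0 := by linear_combination h1
    rcases mul_eq_zero.1 h2 with h3 | h3
    · exact absurd (sub_eq_zero.1 h3).symm hst'
    · exact sub_eq_zero.1 h3
  let bad : ℕ → Set ℝ := fun j => {t ∈ Ioo 0 δ | (inducedMap h)^[j] (γ t) = γ t}
  -- The defect of invariance under the `j`-th iterate is affine in the parameter. Vanishing at two
  -- parameters, it would vanish at `ν` as well, against the period of `ν`.
  have hbad : ∀ j, 1 ≤ j → j < n → (bad j).Subsingleton := by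
    rintro j hj1 hj2 s ⟨hs, hs'⟩ t ⟨ht, ht'⟩
    by_contra hst
    refine hν.2 j hj1 hj2 (prob_ext fun B hB => ?_)
    have e : ∀ r ∈ Ioo 0 δ, (inducedMap h)^[j] (γ r) = γ r →
        (1 - r) * (mass μ (h^[j] ⁻¹' B) - mass μ B) +
          r * (mass ν (h^[j] ⁻¹' B) - mass ν B) = 0 := by
      intro r hr hr'
      have h1 := congrArg (fun ρ => mass ρ B) hr'
      rw [mass_iterate h _ _ hB, hform r hr, hform r hr] at h1
      linear_combination h1
    have e1 := e s hs hs'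
    have e2 := e t ht ht'
    rw [mass_iterate h _ _ hB]
    have e3 : (t - s) * (mass ν (h^[j] ⁻¹' B) - mass ν B) = 0 := by
      linear_combination (1 - s) * e2 - (1 - t) * e1
    rcases mul_eq_zero.1 e3 with h3 | h3
    · exact absurd (sub_eq_zero.1 h3).symm hst
    · exact sub_eq_zero.1 h3
  have hcov : Ioo 0 δ ⊆ (Ioo 0 δ ∩ γ ⁻¹' (U ∩ pointsOfPeriod (inducedMap h) n)) ∪
      ⋃ j ∈ Ico 1 n, bad j := by
    intro t ht
    by_cases hb : ∃ j ∈ Ico 1 n, t ∈ bad j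
    · obtain ⟨j, hj, hb⟩ := hb
      exact Or.inr (mem_biUnion hj hb)
    · refine Or.inl ⟨ht, hγU t ht, ?_, fun j hj1 hj2 he => hb ⟨j, ⟨hj1, hj2⟩, ht, he⟩⟩
      refine prob_ext fun B hB => ?_
      have h1 := congrArg (fun ρ => mass ρ B) hμ
      have h2 := congrArg (fun ρ => mass ρ B) hν.1
      rw [mass_iterate h _ _ hB] at h1 h2 ⊢
      rw [hform t ht, hform t ht, h1, h2]
  have hc : (Ioo 0 δ).Countable := by
    refine Countable.mono hcov (Countable.union ?_ ?_)
    · exact countable_of_injective_of_countable_image (hinj.mono inter_subset_left)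
        (hcount.mono (image_subset_iff.2 inter_subset_right))
    · exact (finite_Ico 1 n).countable.biUnion fun j hj => (hbad j hj.1 hj.2).countable
  exact absurd hc (Cardinal.Real.Ioo_countable_iff.not.2 (not_le.2 hδ))

end Measures

/-! ### Resolved homeomorphisms and their nonwandering measures -/

section Resolved

variable {X : Type*} [MetricSpace X]

/-- Locally constant data adapted to the dynamics of `h`: an invariant label `κ`, a rank `φ` that
does not decrease along orbits, and a phase `ψ` that advances by one modulo `n`, such that the
three together determine a point up to `ε`. Some point increases its rank, and there are at least
two labels. -/
def IsResolved (h : X ≃ₜ X) (m : ℕ) (ε : ℝ) : Prop :=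
  ∃ (n : ℕ) (A : Type) (κ : X → A) (φ : X → ℕ) (ψ : X → ZMod n), 0 < n ∧ m ∣ n ∧
    (IsLocallyConstant κ ∧ IsLocallyConstant φ ∧ IsLocallyConstant ψ) ∧
    (∀ x, κ (h x) = κ x) ∧ (∀ x, φ x ≤ φ (h x)) ∧ (∀ x, ψ (h x) = ψ x + 1) ∧
    (∀ x y, κ x = κ y → φ x = φ y → ψ x = ψ y → dist x y < ε) ∧
    (∃ x, φ x < φ (h x)) ∧ ∃ x y, κ x ≠ κ y

lemma phase_iterate {n : ℕ} {h : X ≃ₜ X} {ψ : X → ZMod n} (hψ : ∀ x, ψ (h x) = ψ x + 1)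
    (k : ℕ) (x : X) : ψ (h^[k] x) = ψ x + k := by
  induction k with
  | zero => simp
  | succ k ih => rw [Function.iterate_succ_apply', hψ, ih]; push_cast; ring

lemma label_iterate {A : Type} {h : X ≃ₜ X} {κ : X → A} (hκ : ∀ x, κ (h x) = κ x)
    (k : ℕ) (x : X) : κ (h^[k] x) = κ x := by
  induction k with
  | zero => rfl
  | succ k ih => rw [Function.iterate_succ_apply', hκ, ih]

lemma map_mem_nonwanderingSet {Y : Type*} [TopologicalSpace Y] {f : Y → Y} (hf : Continuous f)
    {x : Y} (hx : x ∈ nonwanderingSet f) : f x ∈ nonwanderingSet f := by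
  intro U hU
  obtain ⟨n, hn, _, ⟨y, hy, rfl⟩, hy'⟩ := hx _ (hf.continuousAt.preimage_mem_nhds hU)
  refine ⟨n, hn, f (f^[n] y), ⟨f y, hy, ?_⟩, hy'⟩
  rw [← Function.iterate_succ_apply, Function.iterate_succ_apply']

lemma iterate_mem_nonwanderingSet {Y : Type*} [TopologicalSpace Y] {f : Y → Y}
    (hf : Continuous f) {x : Y} (hx : x ∈ nonwanderingSet f) (k : ℕ) :
    f^[k] x ∈ nonwanderingSet f := by
  induction k with
  | zero => exact hx
  | succ k ih => rw [Function.iterate_succ_apply']; exact map_mem_nonwanderingSet hf ih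

lemma recurrentSet_subset_nonwanderingSet {Y : Type*} [TopologicalSpace Y] (f : Y → Y) :
    recurrentSet f ⊆ nonwanderingSet f := by
  intro x hx U hU
  obtain ⟨n, hn, h⟩ := hx U hU
  exact ⟨n, hn, f^[n] x, ⟨x, mem_of_mem_nhds hU, rfl⟩, h⟩

lemma periodicSet_subset_nonwanderingSet {Y : Type*} [TopologicalSpace Y] (f : Y → Y) :
    periodicSet f ⊆ nonwanderingSet f := by
  rintro x ⟨p, hp, hx⟩ U hU
  exact ⟨p, hp, x, ⟨x, mem_of_mem_nhds hU, hx⟩, mem_of_mem_nhds hU⟩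

variable [CompactSpace X] [MeasurableSpace X] [BorelSpace X]

/-- Otherwise some `a` lies strictly between the two masses. Near `μ` every measure has mass above
`a` on `h ⁻¹' U`, hence on every later preimage of `U`, so its images keep mass above `a` on `U` and
never return. -/
lemma mass_preimage_le_of_nonwandering {h : X ≃ₜ X} {μ : Prob X}
    (hμ : μ ∈ nonwanderingSet (inducedMap h)) {U : Set X} (hU : IsClopen U)
    (hinv : U ⊆ h ⁻¹' U) : mass μ (h ⁻¹' U) ≤ mass μ U := by
  by_contra! hlt
  obtain ⟨a, ha1, ha2⟩ := exists_between hlt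
  have hU' : IsClopen (h ⁻¹' U) := hU.preimage h.continuous
  have hV : {ν : Prob X | mass ν U < a ∧ a < mass ν (h ⁻¹' U)} ∈ 𝓝 μ :=
    ((isOpen_lt (continuous_mass_of_isClopen hU) continuous_const).inter
      (isOpen_lt continuous_const (continuous_mass_of_isClopen hU'))).mem_nhds ⟨ha1, ha2⟩
  obtain ⟨n, hn, _, ⟨ν, hν, rfl⟩, hν'⟩ := hμ _ hV
  have h1 := hν'.1
  rw [mass_iterate h _ _ hU.isOpen.measurableSet] at h1
  have hsub : h ⁻¹' U ⊆ h^[n] ⁻¹' U := by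
    obtain ⟨k, rfl⟩ : ∃ k, n = k + 1 := ⟨n - 1, by omega⟩
    intro x hx
    have : ∀ j, h^[j] (h x) ∈ U := by
      intro j
      induction j with
      | zero => exact hx
      | succ j ih => rw [Function.iterate_succ_apply']; exact hinv ih
    exact this k
  have := mass_mono ν hsub
  linarith [hν.2]

/-- The superlevel sets of the rank are clopen and forward invariant, and a point of increasing rank
enters one of them. -/
lemma mass_rank_lt_eq_zero {h : X ≃ₜ X} {φ : X → ℕ} (hφc : IsLocallyConstant φ)
    (hφ : ∀ x, φ x ≤ φ (h x)) {μ : Prob X} (hμ : μ ∈ nonwanderingSet (inducedMap h)) :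
    (μ.toMeasure : Measure X) {x | φ x < φ (h x)} = 0 := by
  have hU : ∀ i, IsClopen (φ ⁻¹' Ici i) := fun i => ⟨⟨hφc (Ici i)ᶜ⟩, hφc (Ici i)⟩
  have hsub : {x | φ x < φ (h x)} ⊆ ⋃ i, (h ⁻¹' (φ ⁻¹' Ici i)) \ (φ ⁻¹' Ici i) := by
    intro x hx
    exact mem_iUnion.2 ⟨φ (h x), le_refl (φ (h x)), not_le.2 (show φ x < φ (h x) from hx)⟩
  refine measure_mono_null hsub (measure_iUnion_null fun i => ?_)
  have hinv : φ ⁻¹' Ici i ⊆ h ⁻¹' (φ ⁻¹' Ici i) := fun x hx => le_trans hx (hφ x)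
  have h1 := mass_preimage_le_of_nonwandering hμ (hU i) hinv
  have h2 := measureReal_sdiff (μ := (μ.toMeasure : Measure X)) hinv (hU i).isOpen.measurableSet
  rw [← measureReal_eq_zero_iff]
  refine le_antisymm ?_ measureReal_nonneg
  rw [h2]
  exact sub_nonpos.2 h1

lemma ae_rank_iterate {h : X ≃ₜ X} {φ : X → ℕ} (hφc : IsLocallyConstant φ)
    (hφ : ∀ x, φ x ≤ φ (h x)) {μ : Prob X} (hμ : μ ∈ nonwanderingSet (inducedMap h)) (k : ℕ) :
    (μ.toMeasure : Measure X) {x | φ (h^[k] x) ≠ φ x} = 0 := by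
  induction k with
  | zero => simp
  | succ k ih =>
    have hmeas : MeasurableSet {x | φ x < φ (h x)} := by
      have : Measurable φ := hφc.continuous.measurable
      exact measurableSet_lt this (this.comp h.continuous.measurable)
    -- The images of `μ` are again nonwandering, so almost no point gains rank at time `k`.
    have h1 := mass_rank_lt_eq_zero hφc hφ
      (iterate_mem_nonwanderingSet (continuous_inducedMap h) hμ k)
    have h2 : (μ.toMeasure : Measure X) (h^[k] ⁻¹' {x | φ x < φ (h x)}) = 0 := by
      rw [← measureReal_eq_zero_iff] at h1 ⊢
      rw [← h1]
      exact (mass_iterate h μ k hmeas).symm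
    refine measure_mono_null ?_ (measure_union_null ih h2)
    intro x hx
    by_contra hcon
    simp only [mem_union, mem_ofPred_eq, not_or, not_not, mem_preimage, not_lt] at hcon
    apply hx
    rw [Function.iterate_succ_apply']
    exact (le_antisymm hcon.2 (hφ _)).trans hcon.1

/-- Nonwandering measures return within `ε` at all multiples of a common time. -/
lemma IsResolved.exists_return {h : X ≃ₜ X} {m : ℕ} {ε : ℝ} (hh : IsResolved h m ε) :
    ∃ n, 0 < n ∧ ∀ μ ∈ nonwanderingSet (inducedMap h), ∀ k, ∀ B, MeasurableSet B →
      mass ((inducedMap h)^[n * k] μ) B ≤ mass μ (Metric.thickening ε B) := by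
  obtain ⟨n, A, κ, φ, ψ, hn, -, ⟨-, hφc, -⟩, hκ, hφ, hψ, hsep, -⟩ := hh
  refine ⟨n, hn, fun μ hμ k B hB => ?_⟩
  rw [mass_iterate h _ _ hB]
  have hnull := ae_rank_iterate hφc hφ hμ (n * k)
  have hsub : h^[n * k] ⁻¹' B ⊆ Metric.thickening ε B ∪ {x | φ (h^[n * k] x) ≠ φ x} := by
    intro x hx
    by_cases hxφ : φ (h^[n * k] x) = φ x
    · refine Or.inl (Metric.mem_thickening_iff.2 ⟨_, hx, ?_⟩)
      refine hsep _ _ (label_iterate hκ _ _).symm hxφ.symm ?_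
      rw [phase_iterate hψ]
      simp
    · exact Or.inr hxφ
  refine (mass_mono μ hsub).trans ((measureReal_union_le _ _).trans ?_)
  rw [(measureReal_eq_zero_iff (measure_ne_top _ _)).2 hnull, add_zero]
  rfl

lemma nonwanderingSet_subset_recurrentSet {h : X ≃ₜ X}
    (hh : ∀ ε > 0, ∃ m, IsResolved h m ε) :
    nonwanderingSet (inducedMap h) ⊆ recurrentSet (inducedMap h) := by
  intro μ hμ U hU
  obtain ⟨ε, hε, hεU⟩ := Metric.mem_nhds_iff.1 hU
  obtain ⟨m, hm⟩ := hh (ε / 2) (half_pos hε)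
  obtain ⟨n, hn, hret⟩ := hm.exists_return
  refine ⟨n, hn, hεU ?_⟩
  have : dist ((inducedMap h)^[n] μ) μ ≤ ε / 2 := by
    refine dist_le_of_mass_le_thickening (half_pos hε).le fun δ B hδ hB => ?_
    have h1 := hret μ hμ 1 B hB
    rw [mul_one] at h1
    have h2 := mass_mono μ (Metric.thickening_mono hδ.le B)
    linarith [half_pos hε]
  rw [Metric.mem_ball]
  linarith

lemma nonwanderingSet_subset_closure_periodicSet {h : X ≃ₜ X}
    (hh : ∀ ε > 0, ∃ m, IsResolved h m ε) :
    nonwanderingSet (inducedMap h) ⊆ closure (periodicSet (inducedMap h)) := by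
  intro μ hμ
  rw [Metric.mem_closure_iff]
  intro ε hε
  obtain ⟨m, hm⟩ := hh (ε / 2) (half_pos hε)
  obtain ⟨n, hn, hret⟩ := hm.exists_return
  -- The return estimate has the same right-hand side at all times `n * k`, so it passes to
  -- averages.
  obtain ⟨ν, hνF, hν⟩ := exists_iterate_fixed h n μ (F := Metric.closedBall μ (ε / 2))
    Metric.isClosed_closedBall (fun N ν hν => by
      refine dist_le_of_mass_le_thickening (half_pos hε).le fun δ B hδ hB => ?_
      have h2 := mass_mono μ (Metric.thickening_mono hδ.le B)
      have h3 : mass ν B ≤ mass μ (Metric.thickening (ε / 2) B) := by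
        rw [hν]
        refine (Finset.sum_le_sum fun i _ => mul_le_mul_of_nonneg_left (hret μ hμ i B hB)
          (by positivity)).trans_eq ?_
        rw [Finset.sum_const, Finset.card_range, nsmul_eq_mul]
        push_cast
        field_simp
      linarith [half_pos hε])
  refine ⟨ν, ⟨n, hn, hν⟩, ?_⟩
  rw [Metric.mem_closedBall, dist_comm] at hνF
  linarith

/-! ### Measures of prescribed period -/

/-- Averaging a point mass in `K` along the `p`-th iterate keeps full mass on `K`. A smaller period
`j` would give full mass to the disjoint sets `K` and `h^[j] ⁻¹' K`. -/
lemma exists_pointsOfPeriod_of_isClopen {h : X ≃ₜ X} {p : ℕ} {K : Set X} (hK : IsClopen K)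
    (hne : K.Nonempty) (hinv : ∀ x ∈ K, h^[p] x ∈ K)
    (hdisj : ∀ j, 1 ≤ j → j < p → ∀ x ∈ K, h^[j] x ∉ K) :
    ∃ ν ∈ pointsOfPeriod (inducedMap h) p, mass ν K = 1 := by
  obtain ⟨x, hx⟩ := hne
  obtain ⟨μ, hμ'⟩ := exists_mass_eq_one x
  have hμ : mass μ K = 1 := hμ' K hx
  have hit : ∀ i, K ⊆ h^[p * i] ⁻¹' K := by
    intro i y hy
    rw [mem_preimage, Function.iterate_mul]
    induction i with
    | zero => exact hy
    | succ i ih => rw [Function.iterate_succ_apply']; exact hinv _ ih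
  obtain ⟨ν, hνK, hν⟩ := exists_iterate_fixed h p μ (F := {ν | mass ν K = 1})
    (isClosed_eq (continuous_mass_of_isClopen hK) continuous_const) (fun N ν hν => by
      have : ∀ i, mass ((inducedMap h)^[p * i] μ) K = 1 := fun i => by
        refine le_antisymm (mass_le_one _ _) ?_
        rw [mass_iterate h _ _ hK.isOpen.measurableSet, ← hμ]
        exact mass_mono μ (hit i)
      change mass ν K = 1
      simp only [hν, this]
      rw [Finset.sum_const, Finset.card_range, nsmul_eq_mul]
      push_cast
      field_simp)
  refine ⟨ν, ⟨hν, fun j hj1 hj2 heq => ?_⟩, hνK⟩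
  have h1 : mass ν (h^[j] ⁻¹' K) = 1 := by
    rw [← mass_iterate h _ _ hK.isOpen.measurableSet, heq]
    exact hνK
  have h2 := measureReal_union (μ := (ν.toMeasure : Measure X)) (s₁ := K)
    (s₂ := h^[j] ⁻¹' K) (disjoint_left.2 fun y hy => hdisj j hj1 hj2 y hy)
    ((h.continuous.iterate j).measurable hK.isOpen.measurableSet)
  have h3 := mass_le_one ν (K ∪ h^[j] ⁻¹' K)
  simp only [mass, mem_ofPred_eq] at h1 h3 hνK
  linarith

lemma IsResolved.exists_pointsOfPeriod_ne {h : X ≃ₜ X} {p : ℕ} {ε : ℝ}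
    (hh : IsResolved h p ε) (μ : Prob X) :
    ∃ ν ∈ pointsOfPeriod (inducedMap h) p, ν ≠ μ := by
  obtain ⟨n, A, κ, φ, ψ, hn, hpn, ⟨hκc, -, hψc⟩, hκ, -, hψ, -, -, x, y, hxy⟩ := hh
  -- Since `p ∣ n`, the phase reduces modulo `p`; its classes are permuted cyclically within each
  -- label class.
  have key : ∀ z, ∃ ν ∈ pointsOfPeriod (inducedMap h) p, mass ν (κ ⁻¹' {κ z}) = 1 := by
    intro z
    let c : X → ZMod p := fun w => ZMod.castHom hpn (ZMod p) (ψ w)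
    have hc : ∀ w, c (h w) = c w + 1 := fun w => by simp only [c, hψ, map_add, map_one]
    have hcc : IsLocallyConstant c := hψc.comp _
    have hK : IsClopen (κ ⁻¹' {κ z} ∩ c ⁻¹' {c z}) :=
      IsClopen.inter ⟨hκc.isClosed_fiber _, hκc.isOpen_fiber _⟩
        ⟨hcc.isClosed_fiber _, hcc.isOpen_fiber _⟩
    obtain ⟨ν, hν, hνK⟩ := exists_pointsOfPeriod_of_isClopen (h := h) (p := p) hK
      ⟨z, rfl, rfl⟩
      (fun w hw => ⟨(label_iterate hκ _ _).trans hw.1, by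
        rw [mem_preimage, phase_iterate hc, ZMod.natCast_self, add_zero]; exact hw.2⟩)
      (fun j hj1 hj2 w hw hw' => by
        have h1 : c (h^[j] w) = c z := hw'.2
        have h2 : c w = c z := hw.2
        rw [phase_iterate hc, h2, add_eq_left, ZMod.natCast_eq_zero_iff] at h1
        exact absurd (Nat.le_of_dvd hj1 h1) (by omega))
    exact ⟨ν, hν, le_antisymm (mass_le_one _ _)
      (hνK.symm.le.trans (mass_mono ν inter_subset_left))⟩
  obtain ⟨ν₁, hν₁, hm₁⟩ := key x
  obtain ⟨ν₂, hν₂, hm₂⟩ := key y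
  by_cases h1 : ν₁ = μ
  · refine ⟨ν₂, hν₂, fun h2 => ?_⟩
    rw [h1, ← h2] at hm₁
    have h3 := measureReal_union (μ := (ν₂.toMeasure : Measure X)) (s₁ := κ ⁻¹' {κ x})
      (s₂ := κ ⁻¹' {κ y}) (disjoint_left.2 fun w hw hw' => hxy (hw.symm.trans hw'))
      (hκc.isOpen_fiber _).measurableSet
    have h4 := mass_le_one ν₂ (κ ⁻¹' {κ x} ∪ κ ⁻¹' {κ y})
    simp only [mass] at hm₁ hm₂ h4
    linarith
  · exact ⟨ν₁, hν₁, h1⟩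

lemma IsResolved.interior_nonwanderingSet {h : X ≃ₜ X} {m : ℕ} {ε : ℝ}
    (hh : IsResolved h m ε) : interior (nonwanderingSet (inducedMap h)) = ∅ := by
  obtain ⟨n, A, κ, φ, ψ, -, -, ⟨-, hφc, -⟩, -, hφ, -, -, ⟨x, hx⟩, -⟩ := hh
  refine eq_empty_of_forall_notMem fun μ hμ => ?_
  obtain ⟨ν, hν'⟩ := exists_mass_eq_one x
  have hν : mass ν {x | φ x < φ (h x)} = 1 := hν' _ hx
  obtain ⟨γ, hγ⟩ := exists_segment μ ν
  obtain ⟨δ, hδ, hδ1, hγU⟩ := exists_segment_mem hγ (mem_interior_iff_mem_nhds.1 hμ)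
  have ht : δ / 2 ∈ Ioo 0 δ := ⟨half_pos hδ, half_lt_self hδ⟩
  have h1 := mass_rank_lt_eq_zero hφc hφ (hγU _ ht)
  rw [← measureReal_eq_zero_iff] at h1
  have h2 := hγ (δ / 2) ht.1.le (ht.2.le.trans hδ1) {x | φ x < φ (h x)}
  rw [mass, h1, hν] at h2
  have h3 := mass_nonneg μ {x | φ x < φ (h x)}
  nlinarith

theorem properties_of_isResolved [Nonempty X] {h : X ≃ₜ X}
    (hh : ∀ m : ℕ, 0 < m → IsResolved h m (1 / m)) :
    (∀ p : ℕ, 1 ≤ p → ¬ (pointsOfPeriod (inducedMap h) p).Countable) ∧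
      (∀ p : ℕ, 1 ≤ p → ∀ μ ∈ pointsOfPeriod (inducedMap h) p, ∀ U ∈ 𝓝 μ, ∀ k : ℕ, 1 ≤ k →
        ¬ (U ∩ pointsOfPeriod (inducedMap h) (k * p)).Countable) ∧
      (recurrentSet (inducedMap h) = nonwanderingSet (inducedMap h) ∧
        chainRecurrentSet (inducedMap h) = Set.univ) ∧
      interior (nonwanderingSet (inducedMap h)) = ∅ ∧
      (periodicSet (inducedMap h) ⊆ nonwanderingSet (inducedMap h) ∧
        nonwanderingSet (inducedMap h) ⊆ closure (periodicSet (inducedMap h))) := by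
  have hres : ∀ ε > 0, ∃ m, IsResolved h m ε := by
    intro ε hε
    obtain ⟨N, hN⟩ := exists_nat_one_div_lt hε
    refine ⟨N + 1, ?_⟩
    obtain ⟨n, A, κ, φ, ψ, h1, h2, h3, h4, h5, h6, h7, h8⟩ := hh (N + 1) (by omega)
    refine ⟨n, A, κ, φ, ψ, h1, h2, h3, h4, h5, h6, fun x y a b c => (h7 x y a b c).trans ?_, h8⟩
    push_cast
    exact hN
  have hB : ∀ p : ℕ, 1 ≤ p → ∀ μ ∈ pointsOfPeriod (inducedMap h) p, ∀ U ∈ 𝓝 μ, ∀ k : ℕ,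
      1 ≤ k → ¬ (U ∩ pointsOfPeriod (inducedMap h) (k * p)).Countable := by
    intro p hp μ hμ U hU k hk
    obtain ⟨ν, hν, hne⟩ := (hh (k * p) (Nat.mul_pos hk hp)).exists_pointsOfPeriod_ne μ
    refine not_countable_inter_pointsOfPeriod ?_ hν hne hU
    rw [mul_comm, Function.iterate_mul]
    exact Function.iterate_fixed hμ.1 k
  refine ⟨fun p hp => ?_, hB, ⟨?_, chainRecurrentSet_inducedMap h⟩, ?_,
    periodicSet_subset_nonwanderingSet _, nonwanderingSet_subset_closure_periodicSet hres⟩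
  · obtain ⟨x⟩ := ‹Nonempty X›
    obtain ⟨ν, -⟩ := exists_mass_eq_one x
    obtain ⟨μ, hμ, -⟩ := (hh p hp).exists_pointsOfPeriod_ne ν
    -- Statement (a) is (b) with `k = 1` and the whole space as neighbourhood, once one point of
    -- period `p` exists.
    have := hB p hp μ hμ univ univ_mem 1 le_rfl
    rwa [univ_inter, one_mul] at this
  · exact (recurrentSet_subset_nonwanderingSet _).antisymm
      (nonwanderingSet_subset_recurrentSet hres)
  · exact (hh 1 one_pos).interior_nonwanderingSet

end Resolved

/-! ### Resolved homeomorphisms form an open set -/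

lemma exists_forall_dist_lt_of_isLocallyConstant {X Y : Type*} [PseudoMetricSpace X] [CompactSpace X]
    {f : X → Y} (hf : IsLocallyConstant f) :
    ∃ δ > 0, ∀ x y, dist y x < δ → f y = f x := by
  obtain ⟨δ, hδ, h⟩ := lebesgue_number_lemma_of_metric (s := univ) (c := fun a => f ⁻¹' {a})
    isCompact_univ (fun a => hf.isOpen_fiber a) (fun x _ => mem_iUnion.2 ⟨f x, rfl⟩)
  refine ⟨δ, hδ, fun x y hxy => ?_⟩
  obtain ⟨a, ha⟩ := h x (mem_univ x)
  have h1 : f y = a := ha hxy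
  have h2 : f x = a := ha (Metric.mem_ball_self hδ)
  rw [h1, h2]

lemma dist_apply_le {X : Type*} [MetricSpace X] [CompactSpace X] (g h : X ≃ₜ X) (x : X) :
    dist (g x) (h x) ≤ dist g h :=
  ContinuousMap.dist_apply_le_dist (f := (ContinuousMap.mk g g.continuous : C(X, X)))
    (g := ContinuousMap.mk h h.continuous) x

lemma dist_homeomorph_lt {X : Type*} [MetricSpace X] [CompactSpace X] {g h : X ≃ₜ X} {ε : ℝ}
    (hε : 0 < ε) (H : ∀ x, dist (g x) (h x) < ε) : dist g h < ε :=
  (ContinuousMap.dist_lt_iff (f := (ContinuousMap.mk g g.continuous : C(X, X)))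
    (g := ContinuousMap.mk h h.continuous) hε).2 H

/-- On a compact space locally constant maps do not see small displacements, so the data for `h`
also serve any `g` near `h`. -/
lemma isOpen_isResolved {X : Type*} [MetricSpace X] [CompactSpace X] (m : ℕ) (ε : ℝ) :
    IsOpen {h : X ≃ₜ X | IsResolved h m ε} := by
  rw [Metric.isOpen_iff]
  rintro h ⟨n, A, κ, φ, ψ, hn, hmn, ⟨hκc, hφc, hψc⟩, hκ, hφ, hψ, hsep, ⟨x, hx⟩, hne⟩
  obtain ⟨δ₁, hδ₁, h₁⟩ := exists_forall_dist_lt_of_isLocallyConstant hκc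
  obtain ⟨δ₂, hδ₂, h₂⟩ := exists_forall_dist_lt_of_isLocallyConstant hφc
  obtain ⟨δ₃, hδ₃, h₃⟩ := exists_forall_dist_lt_of_isLocallyConstant hψc
  refine ⟨min δ₁ (min δ₂ δ₃), lt_min hδ₁ (lt_min hδ₂ hδ₃), fun g hg => ?_⟩
  have hd : ∀ y, dist (g y) (h y) < min δ₁ (min δ₂ δ₃) := fun y =>
    (dist_apply_le g h y).trans_lt hg
  have e₁ : ∀ y, κ (g y) = κ (h y) := fun y => h₁ _ _ ((hd y).trans_le (min_le_left _ _))
  have e₂ : ∀ y, φ (g y) = φ (h y) := fun y =>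
    h₂ _ _ ((hd y).trans_le ((min_le_right _ _).trans (min_le_left _ _)))
  have e₃ : ∀ y, ψ (g y) = ψ (h y) := fun y =>
    h₃ _ _ ((hd y).trans_le ((min_le_right _ _).trans (min_le_right _ _)))
  refine ⟨n, A, κ, φ, ψ, hn, hmn, ⟨hκc, hφc, hψc⟩, fun y => ?_, fun y => ?_, fun y => ?_, hsep,
    ⟨x, ?_⟩, hne⟩
  · rw [e₁, hκ]
  · rw [e₂]; exact hφ y
  · rw [e₃, hψ]
  · rw [e₂]; exact hx

/-! ### Copies of the Cantor space -/

/-- The sequence `b, z 0, z 1, …`. -/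
def prepend (b : Bool) (z : ℕ → Bool) : ℕ → Bool
  | 0 => b
  | i + 1 => z i

/-- The sequence `z 1, z 2, …`. -/
def tail (z : ℕ → Bool) : ℕ → Bool := fun i => z (i + 1)

@[simp] lemma prepend_zero (b : Bool) (z : ℕ → Bool) : prepend b z 0 = b := rfl

@[simp] lemma tail_prepend (b : Bool) (z : ℕ → Bool) : tail (prepend b z) = z := rfl

lemma exists_eq_prepend (z : ℕ → Bool) : ∃ b w, z = prepend b w := by
  refine ⟨z 0, tail z, ?_⟩
  funext i
  cases i <;> rfl

lemma continuous_prepend (b : Bool) : Continuous (prepend b) :=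
  continuous_pi fun i => by
    cases i with
    | zero => exact continuous_const
    | succ i => exact continuous_apply i

lemma continuous_tail : Continuous tail := continuous_pi fun i => continuous_apply (i + 1)

/-- The first digit separates one copy from the remaining ones. -/
lemma nonempty_fin_prod_homeomorph (k : ℕ) :
    Nonempty ((Fin (k + 1) × (ℕ → Bool)) ≃ₜ (ℕ → Bool)) := by
  induction k with
  | zero =>
    exact ⟨Homeomorph.uniqueProd (Fin 1) (ℕ → Bool)⟩
  | succ k ih =>
    obtain ⟨e⟩ := ih
    let E : (Fin (k + 1 + 1) × (ℕ → Bool)) ≃ (ℕ → Bool) :=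
      { toFun := fun v => Fin.cases (motive := fun _ => ℕ → Bool) (prepend false v.2)
          (fun i => prepend true (e (i, v.2))) v.1
        invFun := fun z => cond (z 0)
          (Fin.succ (e.symm (tail z)).1, (e.symm (tail z)).2) (0, tail z)
        left_inv := by
          rintro ⟨i, z⟩
          induction i using Fin.cases <;> simp
        right_inv := by
          intro z
          obtain ⟨b, z, rfl⟩ := exists_eq_prepend z
          cases b <;> simp }
    have hE : Continuous E := by
      rw [continuous_prod_of_discrete_left]
      intro i
      induction i using Fin.cases with
      | zero => exact continuous_prepend false
      | succ i =>
        exact (continuous_prepend true).comp (e.continuous.comp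
          (continuous_const.prodMk continuous_id))
    exact ⟨hE.homeoOfEquivCompactToT2⟩

lemma nonempty_prod_homeomorph (F : Type*) [Finite F] [Nonempty F] [TopologicalSpace F]
    [DiscreteTopology F] : Nonempty ((F × (ℕ → Bool)) ≃ₜ (ℕ → Bool)) := by
  obtain ⟨k, ⟨e⟩⟩ := Finite.exists_equiv_fin F
  obtain ⟨l, rfl⟩ : ∃ l, k = l + 1 := by
    refine Nat.exists_eq_succ_of_ne_zero ?_
    rintro rfl
    exact (e (Classical.arbitrary F)).elim0
  obtain ⟨E⟩ := nonempty_fin_prod_homeomorph l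
  exact ⟨(e.toHomeomorphOfDiscrete.prodCongr (Homeomorph.refl _)).trans E⟩

/-- Copies of the Cantor space indexed by `W` can be distributed over copies indexed by `P`
according to any surjection `W → P`. -/
lemma exists_homeomorph_over {W P : Type*} [Finite W] [TopologicalSpace W] [DiscreteTopology W]
    [Finite P] [TopologicalSpace P] [DiscreteTopology P] {f : W → P} (hf : f.Surjective) :
    ∃ E : (W × (ℕ → Bool)) ≃ₜ (P × (ℕ → Bool)), ∀ v, (E v).1 = f v.1 := by
  have H : ∀ b, Nonempty (({w // f w = b} × (ℕ → Bool)) ≃ₜ (ℕ → Bool)) := fun b => by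
    have : Nonempty {w // f w = b} := let ⟨w, hw⟩ := hf b; ⟨⟨w, hw⟩⟩
    exact nonempty_prod_homeomorph _
  let e := fun b => (H b).some
  let E : (W × (ℕ → Bool)) ≃ (P × (ℕ → Bool)) :=
    { toFun := fun v => (f v.1, e (f v.1) (⟨v.1, rfl⟩, v.2))
      invFun := fun v => (((e v.1).symm v.2).1.1, ((e v.1).symm v.2).2)
      left_inv := by
        rintro ⟨w, z⟩
        simp
      right_inv := by
        rintro ⟨b, z⟩
        obtain ⟨⟨⟨w, rfl⟩, z⟩, rfl⟩ := (e b).surjective z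
        dsimp only
        rw [(e (f w)).symm_apply_apply] }
  have hE : Continuous E := by
    rw [continuous_prod_of_discrete_left]
    intro w
    exact (continuous_const (y := f w)).prodMk ((e (f w)).continuous.comp
      ((continuous_const (y := (⟨w, rfl⟩ : {v // f v = f w}))).prodMk continuous_id))
  exact ⟨hE.homeoOfEquivCompactToT2, fun v => rfl⟩

/-! ### The model homeomorphism -/

/-- The graph formed by two loops of length `n`, on `[0, n)` and on `[3n, 4n)`, and a bar leading
from the first to the second. -/
def IsStep (n i j : ℕ) : Prop :=
  j = i + 1 ∨ (i + 1 = n ∧ j = 0) ∨ (i + 1 = 4 * n ∧ j = 3 * n)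

/-- Branching is compatible with bijectivity because the fibres are Cantor sets. At the exit `n - 1`
of the first loop the first digit selects the edge and is dropped; at `3 * n`, where two edges meet,
a new first digit records the edge taken. -/
lemma exists_model {n : ℕ} (hn : 0 < n) :
    ∃ T : (Fin (4 * n) × (ℕ → Bool)) ≃ₜ (Fin (4 * n) × (ℕ → Bool)),
      ∀ v, IsStep n v.1 (T v).1 := by
  let E : (Fin (4 * n) × (ℕ → Bool)) ≃ (Fin (4 * n) × (ℕ → Bool)) :=
    { toFun := fun v =>
        if h1 : (v.1 : ℕ) + 1 = n then
          (cond (v.2 0) ⟨n, by omega⟩ ⟨0, by omega⟩, tail v.2)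
        else if h2 : (v.1 : ℕ) + 1 = 3 * n then (⟨3 * n, by omega⟩, prepend true v.2)
        else if h3 : (v.1 : ℕ) + 1 = 4 * n then (⟨3 * n, by omega⟩, prepend false v.2)
        else (⟨v.1 + 1, by omega⟩, v.2)
      invFun := fun v =>
        if h1 : (v.1 : ℕ) = 0 then (⟨n - 1, by omega⟩, prepend false v.2)
        else if h2 : (v.1 : ℕ) = n then (⟨n - 1, by omega⟩, prepend true v.2)
        else if h3 : (v.1 : ℕ) = 3 * n then
          (cond (v.2 0) ⟨3 * n - 1, by omega⟩ ⟨4 * n - 1, by omega⟩, tail v.2)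
        else (⟨v.1 - 1, by omega⟩, v.2)
      left_inv := by
        rintro ⟨⟨i, hi⟩, z⟩
        dsimp only
        by_cases h1 : i + 1 = n
        · obtain ⟨b, z, rfl⟩ := exists_eq_prepend z
          cases b
          · simp [h1]
            omega
          · simp [h1, hn.ne']
            omega
        · by_cases h2 : i + 1 = 3 * n
          · have : ¬ 3 * n = n := by omega
            simp [h2, this, hn.ne']
            omega
          · by_cases h3 : i + 1 = 4 * n
            · have h4 : ¬ 3 * n = n := by omega
              have h5 : ¬ 4 * n = n := by omega
              have h6 : ¬ 4 * n = 3 * n := by omega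
              simp [h3, h4, h5, h6, hn.ne']
              omega
            · simp [h1, h2, h3]
      right_inv := by
        rintro ⟨⟨i, hi⟩, z⟩
        dsimp only
        by_cases h1 : i = 0
        · have : n - 1 + 1 = n := by omega
          simp [h1, this]
        · by_cases h2 : i = n
          · have : n - 1 + 1 = n := by omega
            simp [h2, this, hn.ne']
          · by_cases h3 : i = 3 * n
            · have h4 : ¬ 3 * n = n := by omega
              have h5 : ¬ 4 * n = n := by omega
              have h6 : ¬ 4 * n = 3 * n := by omega
              have h7 : 3 * n - 1 + 1 = 3 * n := by omega
              have h8 : 4 * n - 1 + 1 = 4 * n := by omega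
              obtain ⟨b, z, rfl⟩ := exists_eq_prepend z
              cases b <;> simp [h3, h4, h5, h6, h7, h8, hn.ne']
            · have h4 : i - 1 + 1 = i := by omega
              have h5 : ¬ i = 4 * n := by omega
              simp [h1, h2, h3, h4, h5] }
  have hE : Continuous E := by
    rw [continuous_prod_of_discrete_left]
    rintro ⟨i, hi⟩
    have hp := continuous_prepend
    have ht := continuous_tail
    by_cases h1 : i + 1 = n
    · have hc := (continuous_of_discreteTopology (f := fun b : Bool =>
        (cond b ⟨n, by omega⟩ ⟨0, by omega⟩ : Fin (4 * n)))).comp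
          (continuous_apply (A := fun _ : ℕ => Bool) 0)
      exact (hc.prodMk ht).congr fun z => by simp [E, h1]
    · by_cases h2 : i + 1 = 3 * n
      · exact ((continuous_const (y := (⟨3 * n, by omega⟩ : Fin (4 * n)))).prodMk (hp true)).congr fun z => by
          simp only [E, Equiv.coe_fn_mk]; rw [dif_neg h1, dif_pos h2]
      · by_cases h3 : i + 1 = 4 * n
        · exact ((continuous_const (y := (⟨3 * n, by omega⟩ : Fin (4 * n)))).prodMk (hp false)).congr fun z => by
            simp only [E, Equiv.coe_fn_mk]; rw [dif_neg h1, dif_neg h2, dif_pos h3]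
        · exact ((continuous_const (y := (⟨i + 1, by omega⟩ : Fin (4 * n)))).prodMk
            continuous_id).congr fun z => by
            simp only [E, Equiv.coe_fn_mk]; rw [dif_neg h1, dif_neg h2, dif_neg h3]; rfl
  refine ⟨hE.homeoOfEquivCompactToT2, ?_⟩
  rintro ⟨⟨i, hi⟩, z⟩
  change IsStep n i (E (⟨i, hi⟩, z)).1
  simp only [E, Equiv.coe_fn_mk, IsStep]
  split_ifs with h1 h2 h3
  · cases z 0 <;> simp <;> omega
  · simp; omega
  · simp; omega
  · simp

/-! ### Resolved homeomorphisms are dense -/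

lemma exists_iterate_two_mul_eq {P : Type*} [Finite P] (f : P → P) {m : ℕ} (hm : 0 < m) :
    ∃ n, 0 < n ∧ m ∣ n ∧ f^[2 * n] = f^[n] := by
  obtain ⟨i, j, hij, h⟩ : ∃ i j, i < j ∧ f^[i] = f^[j] := by
    obtain ⟨i, j, hne, h⟩ := Finite.exists_ne_map_eq_of_infinite fun k : ℕ => f^[k]
    rcases lt_or_gt_of_ne hne with hlt | hlt
    · exact ⟨i, j, hlt, h⟩
    · exact ⟨j, i, hlt, h.symm⟩
  obtain ⟨s, rfl⟩ := Nat.exists_eq_add_of_lt hij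
  have h1 : ∀ k, i ≤ k → f^[k + (s + 1)] = f^[k] := by
    intro k hk
    obtain ⟨l, rfl⟩ := Nat.exists_eq_add_of_le hk
    rw [show i + l + (s + 1) = l + (i + s + 1) by ring, Function.iterate_add, ← h,
      ← Function.iterate_add, add_comm l i]
  have h2 : ∀ t k, i ≤ k → f^[k + t * (s + 1)] = f^[k] := by
    intro t k hk
    induction t with
    | zero => simp
    | succ t ih => rw [add_mul, one_mul, ← add_assoc, h1 _ (by omega), ih]
  -- A multiple of the eventual period `s + 1` and of `m`, at least as large as the preperiod `i`.
  refine ⟨m * (i + 1) * (s + 1), by positivity, ⟨(i + 1) * (s + 1), by ring⟩, ?_⟩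
  rw [two_mul]
  exact h2 _ _ (by nlinarith [Nat.mul_pos hm (Nat.succ_pos s), Nat.zero_le (m * i * s)])

/-- The vertex over position `j` of the graph `IsStep n` obtained by following `σ` forwards and `π`
backwards from `a`, which is placed at position `2n`. -/
def pathLabel {P : Type*} (σ π : P → P) (n : ℕ) (a : P) (j : ℕ) : P :=
  if 2 * n ≤ j then σ^[j - 2 * n] a else π^[2 * n - j] a

/-- The loops close because positions `0` and `n` carry the same vertex by `hπ`, and the path
continued to position `4 * n` would be back at the vertex of `3 * n` by `hσ`. -/
lemma pathLabel_step {P : Type*} {σ π : P → P} {n : ℕ} (hn : 0 < n)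
    (hσ : σ^[2 * n] = σ^[n]) (hπ : π^[2 * n] = π^[n]) {E : P → P → Prop}
    (hEσ : ∀ a, E a (σ a)) (hEπ : ∀ a, E (π a) a) (a : P) {i j : ℕ} (hij : IsStep n i j) :
    E (pathLabel σ π n a i) (pathLabel σ π n a j) := by
  rcases hij with rfl | ⟨hi, rfl⟩ | ⟨hi, rfl⟩
  · by_cases h : 2 * n ≤ i
    · rw [pathLabel, pathLabel, if_pos h, if_pos (by omega),
        show i + 1 - 2 * n = (i - 2 * n) + 1 by omega, Function.iterate_succ_apply']
      exact hEσ _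
    · have e : pathLabel σ π n a (i + 1) = π^[2 * n - (i + 1)] a := by
        rw [pathLabel]
        split_ifs with h'
        · rw [show i + 1 - 2 * n = 0 by omega, show 2 * n - (i + 1) = 0 by omega]
          rfl
        · rfl
      rw [e, pathLabel, if_neg h, show 2 * n - i = (2 * n - (i + 1)) + 1 by omega,
        Function.iterate_succ_apply']
      exact hEπ _
  · rw [pathLabel, pathLabel, if_neg (by omega), if_neg (by omega),
      show 2 * n - i = n + 1 by omega, Nat.sub_zero, hπ, Function.iterate_succ_apply']
    exact hEπ _
  · rw [pathLabel, pathLabel, if_pos (by omega), if_pos (by omega),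
      show 3 * n - 2 * n = n by omega, ← hσ, show 2 * n = (i - 2 * n) + 1 by omega,
      Function.iterate_succ_apply', show i - (i - 2 * n + 1) = i - 2 * n by omega]
    exact hEσ _

/-- The rank of a position: constant on each loop of `IsStep n` and increasing along the bar. -/
def stepRank (n j : ℕ) : ℕ := if j < n then 0 else if 3 * n ≤ j then 3 * n else j

lemma stepRank_le {n i j : ℕ} (hij : IsStep n i j) : stepRank n i ≤ stepRank n j := by
  unfold stepRank
  unfold IsStep at hij
  split_ifs <;> omega

/-- On the bar the rank is the position; a loop has `n` positions, which the residue modulo `n`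
separates. -/
lemma eq_of_stepRank_eq {n i j : ℕ} (hi : i < 4 * n) (hj : j < 4 * n)
    (hr : stepRank n i = stepRank n j) (hmod : i ≡ j [MOD n]) : i = j := by
  unfold stepRank at hr
  by_cases hi1 : i < n
  · have hj1 : j < n := by
      by_contra
      split_ifs at hr <;> omega
    rwa [Nat.ModEq, Nat.mod_eq_of_lt hi1, Nat.mod_eq_of_lt hj1] at hmod
  · by_cases hi2 : 3 * n ≤ i
    · have hj2 : 3 * n ≤ j := by
        by_contra
        split_ifs at hr <;> omega
      obtain ⟨r, rfl⟩ := Nat.exists_eq_add_of_le hi2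
      obtain ⟨t, rfl⟩ := Nat.exists_eq_add_of_le hj2
      have := Nat.ModEq.add_left_cancel' _ hmod
      rw [Nat.ModEq, Nat.mod_eq_of_lt (by omega), Nat.mod_eq_of_lt (by omega)] at this
      rw [this]
    · split_ifs at hr <;> omega

lemma exists_isResolved_near {X : Type*} [MetricSpace X] [CompactSpace X] {P : Type} [Finite P]
    [Nontrivial P] [TopologicalSpace P] [DiscreteTopology P] (e : X ≃ₜ (P × (ℕ → Bool)))
    {η : ℝ} (he : ∀ x y, (e x).1 = (e y).1 → dist x y < η) {ε : ℝ} (h : X ≃ₜ X)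
    (hη : ∀ x y, dist x y < η → dist (h x) (h y) < ε) {m : ℕ} (hm : 0 < m) :
    ∃ g : X ≃ₜ X, IsResolved g m η ∧ ∀ x, dist (g x) (h x) < η + ε := by
  let s : P → X := fun a => e.symm (a, fun _ => false)
  have hs : ∀ a, (e (s a)).1 = a := fun a => by simp [s]
  let σ : P → P := fun a => (e (h (s a))).1
  -- The map `σ` gives a possible next cell and `π` a possible previous cell. Treating them as one
  -- map on pairs provides a common `n`.
  let π : P → P := fun a => (e (h.symm (s a))).1
  obtain ⟨n, hn, hmn, hf⟩ := exists_iterate_two_mul_eq (Prod.map σ π) hm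
  rw [Prod.map_iterate, Prod.map_iterate] at hf
  have hσ : σ^[2 * n] = σ^[n] := funext fun a => congrArg Prod.fst (congrFun hf (a, a))
  have hπ : π^[2 * n] = π^[n] := funext fun a => congrArg Prod.snd (congrFun hf (a, a))
  let f : P × Fin (4 * n) → P := fun w => pathLabel σ π n w.1 w.2
  -- Every cell occurs on its own path at position `2 * n`, so each cell splits into Cantor sets,
  -- one for each of its occurrences.
  have hfs : f.Surjective := fun a => ⟨(a, ⟨2 * n, by omega⟩), by simp [f, pathLabel]⟩
  obtain ⟨E, hE⟩ := exists_homeomorph_over hfs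
  obtain ⟨T, hT⟩ := exists_model hn
  let Φ : X ≃ₜ (P × (Fin (4 * n) × (ℕ → Bool))) :=
    (e.trans E.symm).trans (Homeomorph.prodAssoc _ _ _)
  have hΦ : ∀ x, (e x).1 = pathLabel σ π n (Φ x).1 (Φ x).2.1 := by
    intro x
    have := hE (E.symm (e x))
    rw [E.apply_symm_apply] at this
    exact this
  let g : X ≃ₜ X := (Φ.trans ((Homeomorph.refl P).prodCongr T)).trans Φ.symm
  have hg : ∀ x, Φ (g x) = ((Φ x).1, T (Φ x).2) := fun x => Φ.apply_symm_apply _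
  have hstep : ∀ x, IsStep n (Φ x).2.1 (Φ (g x)).2.1 := fun x => by
    rw [hg]; exact hT _
  have hpos : IsLocallyConstant fun x => (Φ x).2.1 :=
    IsLocallyConstant.iff_continuous _ |>.2 (by fun_prop)
  refine ⟨g, ⟨n, P, fun x => (Φ x).1, fun x => stepRank n (Φ x).2.1,
    fun x => (((Φ x).2.1 : ℕ) : ZMod n), hn, hmn, ⟨?_, ?_, ?_⟩, ?_, ?_, ?_, ?_, ?_, ?_⟩, ?_⟩
  · exact IsLocallyConstant.iff_continuous _ |>.2 (by fun_prop)
  · exact hpos.comp fun i => stepRank n i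
  · exact hpos.comp fun i => ((i : ℕ) : ZMod n)
  · intro x
    dsimp only
    rw [hg]
  · exact fun x => stepRank_le (hstep x)
  · intro x
    have h1 := hstep x
    dsimp only
    generalize ((Φ (g x)).2.1 : ℕ) = j at h1 ⊢
    generalize ((Φ x).2.1 : ℕ) = i at h1 ⊢
    rw [← Nat.cast_succ, ZMod.natCast_eq_natCast_iff]
    rcases h1 with rfl | ⟨hi, rfl⟩ | ⟨hi, rfl⟩
    · rfl
    · rw [Nat.succ_eq_add_one, hi]
      exact (Nat.modEq_zero_iff_dvd.2 dvd_rfl).symm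
    · rw [Nat.succ_eq_add_one, hi]
      exact (Nat.modEq_zero_iff_dvd.2 (dvd_mul_left _ _)).trans
        (Nat.modEq_zero_iff_dvd.2 (dvd_mul_left _ _)).symm
  · intro x y hκ hφ hψ
    apply he
    rw [hΦ, hΦ]
    have := eq_of_stepRank_eq (Φ x).2.1.2 (Φ y).2.1.2 hφ ((ZMod.natCast_eq_natCast_iff _ _ _).1 hψ)
    dsimp only at hκ
    rw [hκ, this]
  · obtain ⟨a⟩ : Nonempty P := inferInstance
    -- Position `n` is where the bar begins; the only edge from it leads to `n + 1`, still on the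
    -- bar.
    let x := Φ.symm (a, ⟨n, by omega⟩, fun _ => false)
    have hx : ((Φ x).2.1 : ℕ) = n := by simp [x]
    refine ⟨x, ?_⟩
    have h1 := hstep x
    dsimp only
    rw [hx] at h1 ⊢
    unfold IsStep at h1
    unfold stepRank
    split_ifs <;> omega
  · obtain ⟨a, b, hab⟩ := exists_pair_ne P
    exact ⟨Φ.symm (a, ⟨0, by omega⟩, fun _ => false), Φ.symm (b, ⟨0, by omega⟩, fun _ => false),
      by simpa using hab⟩
  · intro x
    -- Each edge between cells is realised by an actual point `y` and its image under `h`. Thus `g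
    -- x` is close to `h y`, and `h y` to `h x` by uniform continuity.
    obtain ⟨y, hy1, hy2⟩ : ∃ y, (e y).1 = (e x).1 ∧ (e (h y)).1 = (e (g x)).1 := by
      rw [hΦ x, hΦ (g x), show (Φ (g x)).1 = (Φ x).1 by rw [hg]]
      refine pathLabel_step hn hσ hπ (E := fun a b => ∃ y, (e y).1 = a ∧ (e (h y)).1 = b)
        (fun a => ⟨s a, hs a, rfl⟩) (fun a => ⟨h.symm (s a), rfl, ?_⟩) _ (hstep x)
      rw [h.apply_symm_apply, hs]
    calc dist (g x) (h x) ≤ dist (g x) (h y) + dist (h y) (h x) := dist_triangle _ _ _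
      _ < η + ε := add_lt_add (he _ _ hy2.symm) (hη _ _ (he _ _ hy1))

/-- The Cantor space splits off its first `k` coordinates. -/
lemma exists_homeomorph_split (k : ℕ) :
    ∃ e : Cantor ≃ₜ ((Fin k → Bool) × (ℕ → Bool)),
      ∀ (x : ℕ → Bool) (i : Fin k), (e x).1 i = x i := by
  let E : ((Fin k → Bool) × (ℕ → Bool)) ≃ (ℕ → Bool) :=
    { toFun := fun v i => if hi : i < k then v.1 ⟨i, hi⟩ else v.2 (i - k)
      invFun := fun x => (fun i => x i, fun i => x (i + k))
      left_inv := by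
        rintro ⟨a, z⟩
        simp
      right_inv := by
        intro x
        funext i
        by_cases hi : i < k
        · simp [hi]
        · simp [hi, Nat.sub_add_cancel (not_lt.1 hi)] }
  have hE : Continuous E.symm := by
    refine Continuous.prodMk ?_ ?_ <;> exact continuous_pi fun i => continuous_apply _
  have hE' : Continuous E := by
    refine continuous_pi fun i => ?_
    by_cases hi : i < k
    · simp only [E, Equiv.coe_fn_mk, hi, dite_true]
      fun_prop
    · simp only [E, Equiv.coe_fn_mk, hi, dite_false]
      fun_prop
  exact ⟨{ toEquiv := E.symm, continuous_toFun := hE, continuous_invFun := hE' },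
    fun x i => rfl⟩

lemma dense_isResolved {m : ℕ} (hm : 0 < m) {δ : ℝ} (hδ : 0 < δ) :
    Dense {h : Cantor ≃ₜ Cantor | IsResolved h m δ} := by
  rw [Metric.dense_iff]
  intro h ε hε
  obtain ⟨η, hη, hη'⟩ := Metric.uniformContinuous_iff.1
    (CompactSpace.uniformContinuous_of_continuous h.continuous) (ε / 2) (half_pos hε)
  -- Cells fixing `k + 1` digits are finer than the modulus of continuity `η`, the resolution `δ`
  -- and half of the allowed perturbation.
  obtain ⟨k, hk⟩ := exists_nat_one_div_lt (lt_min (lt_min hη hδ) (half_pos hε))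
  obtain ⟨e, he⟩ := exists_homeomorph_split (k + 1)
  have hdist : ∀ x y : Cantor, (e x).1 = (e y).1 → dist x y < 1 / ((k : ℝ) + 1) := by
    intro x y hxy
    refine (cantorDist_lt_iff x y k).2 fun i hi => ?_
    have h1 := congrFun hxy ⟨i, Nat.lt_succ_of_le hi⟩
    exact ((he x _).symm.trans (h1.trans (he y _))).symm
  have k1 : 1 / ((k : ℝ) + 1) < η := hk.trans_le ((min_le_left _ _).trans (min_le_left _ _))
  have k2 : 1 / ((k : ℝ) + 1) < δ := hk.trans_le ((min_le_left _ _).trans (min_le_right _ _))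
  have k3 : 1 / ((k : ℝ) + 1) < ε / 2 := hk.trans_le (min_le_right _ _)
  obtain ⟨g, hg, hgh⟩ := exists_isResolved_near e hdist h (ε := ε / 2)
    (fun x y hxy => hη' (hxy.trans k1)) hm
  refine ⟨g, ?_, ?_⟩
  · exact dist_homeomorph_lt hε fun x => (hgh x).trans (by linarith)
  · obtain ⟨n, A, κ, φ, ψ, h1, h2, h3, h4, h5, h6, h7, h8⟩ := hg
    exact ⟨n, A, κ, φ, ψ, h1, h2, h3, h4, h5, h6,
      fun x y a b c => (h7 x y a b c).trans k2, h8⟩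

end InducedDynamics

open InducedDynamics
theorem theorem5p2 :
    ∀ᶠ h : Cantor ≃ₜ Cantor in residual (Cantor ≃ₜ Cantor),
      -- (a)
      (∀ p : ℕ, 1 ≤ p → ¬ (pointsOfPeriod (inducedMap h) p).Countable) ∧
      -- (b)
      (∀ p : ℕ, 1 ≤ p → ∀ μ ∈ pointsOfPeriod (inducedMap h) p, ∀ U ∈ 𝓝 μ, ∀ k : ℕ, 1 ≤ k →
        ¬ (U ∩ pointsOfPeriod (inducedMap h) (k * p)).Countable) ∧
      -- (c)
      (recurrentSet (inducedMap h) = nonwanderingSet (inducedMap h) ∧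
        chainRecurrentSet (inducedMap h) = Set.univ) ∧
      -- (d)
      interior (nonwanderingSet (inducedMap h)) = ∅ ∧
      -- (e)
      (periodicSet (inducedMap h) ⊆ nonwanderingSet (inducedMap h) ∧
        nonwanderingSet (inducedMap h) ⊆ closure (periodicSet (inducedMap h))) := by
  have hres : ∀ m : ℕ, ∀ᶠ h : Cantor ≃ₜ Cantor in residual (Cantor ≃ₜ Cantor),
      0 < m → IsResolved h m (1 / m) := by
    intro m
    rcases Nat.eq_zero_or_pos m with rfl | hm
    · exact Eventually.of_forall fun _ h0 => absurd h0 (lt_irrefl 0)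
    · exact mem_of_superset (residual_of_dense_open (isOpen_isResolved m (1 / m))
        (dense_isResolved hm (by positivity))) fun h hh _ => hh
  have : Nonempty Cantor := ⟨fun _ : ℕ => false⟩
  filter_upwards [eventually_countable_forall.2 hres] with h hh
  exact properties_of_isResolved hh
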